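/- Let $M$ be a compact K\"ahler manifold of complex dimension $n \ge 1$ with smooth (possibly empty) boundary: $M$ is a compact Hausdorff smooth manifold with boundary of real dimension $2n$, equipped with a smooth integrable complex structure $J$ (vanishing Nijenhuis tensor) and a smooth Riemannian metric $g$, both smooth up to the boundary, such that $g(JX,JY)=g(X,Y)$ and the fundamental form $\omega(X,Y)=g(JX,Y)$ is closed. Assume that $M$ is holomorphically separable, i.e. for all $x,y\in M$ with $x\neq y$ there is a complex-valued $f\in C^\infty(M)$ that is holomorphic in the interior of $M$ (that is, $df\circ J = i\,df$ there) with $f(x)\neq f(y)$. Let $\Delta_g$ be the Laplace--Beltrami operator of $g$, and let $C(M)$ and $C^\infty(M)$ denote spaces of complex-valued functions. If $\mu$ is a bounded measure on $M$ (i.e. $\mu\in (C(M))^*$, a continuous linear functional on $C(M)$) and $$\int_M u_1u_2\,d\mu = 0$$ for all $u_1,u_2\in C^\infty(M)$ with $\Delta_g u_1=\Delta_g u_2=0$ in $M$, then $\mu=0$. -/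

import Mathlib

open scoped Manifold ContDiff Bundle

noncomputable section

namespace KahlerCalderon

variable {m : ℕ} {H : Type*} [TopologicalSpace H]

/-- A smooth Riemannian metric on `M` (smooth up to the boundary). -/
abbrev RiemannianMetric (I : ModelWithCorners ℝ (EuclideanSpace ℝ (Fin m)) H)
    (M : Type*) [TopologicalSpace M] [ChartedSpace H M] [IsManifold I ∞ M] :=
  Bundle.ContMDiffRiemannianMetric I ∞ (EuclideanSpace ℝ (Fin m))
    (fun x : M => TangentSpace I x)

/-- A smooth almost complex structure on `M` (smooth up to the boundary): a smooth field of
endomorphisms `J` of the tangent bundle with `J² = -1`. -/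
structure AlmostComplexStructure (I : ModelWithCorners ℝ (EuclideanSpace ℝ (Fin m)) H)
    (M : Type*) [TopologicalSpace M] [ChartedSpace H M] [IsManifold I ∞ M] where
  /-- The endomorphism of each tangent space. -/
  toFun : ∀ x : M, TangentSpace I x →L[ℝ] TangentSpace I x
  sq_eq_neg : ∀ (x : M) (v : TangentSpace I x), toFun x (toFun x v) = -v
  contMDiff : ContMDiff I
    (I.prod 𝓘(ℝ, EuclideanSpace ℝ (Fin m) →L[ℝ] EuclideanSpace ℝ (Fin m))) ∞
    (fun x : M => Bundle.TotalSpace.mk'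
      (EuclideanSpace ℝ (Fin m) →L[ℝ] EuclideanSpace ℝ (Fin m))
      (E := fun x : M => TangentSpace I x →L[ℝ] TangentSpace I x) x (toFun x))

variable {I : ModelWithCorners ℝ (EuclideanSpace ℝ (Fin m)) H}
  {M : Type*} [TopologicalSpace M] [ChartedSpace H M] [IsManifold I ∞ M]

/-- `J` is integrable: for all smooth vector fields `X`, `Y` on `M` the Nijenhuis tensor
`N(X, Y) = [X, Y] + J [J X, Y] + J [X, J Y] - [J X, J Y]` vanishes. -/
def AlmostComplexStructure.IsIntegrable (J : AlmostComplexStructure I M) : Prop :=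
  ∀ X Y : ∀ x : M, TangentSpace I x,
    ContMDiff I I.tangent ∞ (fun x => (X x : TangentBundle I M)) →
    ContMDiff I I.tangent ∞ (fun x => (Y x : TangentBundle I M)) →
    ∀ x : M,
      VectorField.mlieBracket I X Y x
        + J.toFun x (VectorField.mlieBracket I (fun p => J.toFun p (X p)) Y x)
        + J.toFun x (VectorField.mlieBracket I X (fun p => J.toFun p (Y p)) x)
        - VectorField.mlieBracket I (fun p => J.toFun p (X p)) (fun p => J.toFun p (Y p)) x = 0

/-! ### Local coordinates

The chart at `p : M` is `extChartAt I p`, with values in the convex set `Set.range I`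
(a half-space, for a manifold with boundary); derivatives in the chart are taken within this
set, so that they make sense up to the boundary. -/

/-- The `i`-th partial derivative `∂ᵢ f` at `y`, within the range of the model `I`. -/
def partialDeriv (I : ModelWithCorners ℝ (EuclideanSpace ℝ (Fin m)) H)
    {F : Type*} [NormedAddCommGroup F] [NormedSpace ℝ F]
    (i : Fin m) (f : EuclideanSpace ℝ (Fin m) → F) (y : EuclideanSpace ℝ (Fin m)) : F :=
  fderivWithin ℝ f (Set.range I) y (EuclideanSpace.single i (1 : ℝ))

/-- The `i`-th coordinate vector field of the chart at `p`, at the point with coordinates `y`. -/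
def coordField (I : ModelWithCorners ℝ (EuclideanSpace ℝ (Fin m)) H) (p : M) (i : Fin m)
    (y : EuclideanSpace ℝ (Fin m)) : TangentSpace I ((extChartAt I p).symm y) :=
  mfderivWithin 𝓘(ℝ, EuclideanSpace ℝ (Fin m)) I (extChartAt I p).symm (Set.range I) y
    (EuclideanSpace.single i (1 : ℝ) : EuclideanSpace ℝ (Fin m))

/-- The matrix `(g_{ij})` of the metric in the chart at `p`. -/
def metricMatrix (g : RiemannianMetric I M) (p : M) (y : EuclideanSpace ℝ (Fin m)) :
    Matrix (Fin m) (Fin m) ℝ :=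
  Matrix.of fun i j =>
    g.inner ((extChartAt I p).symm y) (coordField I p i y) (coordField I p j y)

/-- The coefficients `ω_{ij}`, in the chart at `p`, of the fundamental form
`ω(X, Y) = g(J X, Y)`. -/
def fundamentalForm (g : RiemannianMetric I M) (J : AlmostComplexStructure I M) (p : M)
    (i j : Fin m) (y : EuclideanSpace ℝ (Fin m)) : ℝ :=
  g.inner ((extChartAt I p).symm y) (J.toFun ((extChartAt I p).symm y) (coordField I p i y))
    (coordField I p j y)

/-- `(M, g, J)` is Kähler: `J` is an integrable complex structure, `g` is Hermitian
with respect to `J`, and the fundamental form is closed, `dω = 0`. -/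
structure IsKahler (g : RiemannianMetric I M) (J : AlmostComplexStructure I M) : Prop where
  integrable : J.IsIntegrable
  hermitian : ∀ (x : M) (v w : TangentSpace I x),
    g.inner x (J.toFun x v) (J.toFun x w) = g.inner x v w
  closed : ∀ (p : M), ∀ y ∈ (extChartAt I p).target, ∀ i j k : Fin m,
    partialDeriv I i (fundamentalForm g J p j k) y
      + partialDeriv I j (fundamentalForm g J p k i) y
      + partialDeriv I k (fundamentalForm g J p i j) y = 0

/-- The Christoffel symbols
`Γᵏᵢⱼ = ½ ∑ₗ gᵏˡ (∂ᵢ gⱼₗ + ∂ⱼ gᵢₗ - ∂ₗ gᵢⱼ)` of `g` in the chart at `p`. -/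
def christoffel (g : RiemannianMetric I M) (p : M) (k i j : Fin m)
    (y : EuclideanSpace ℝ (Fin m)) : ℝ :=
  (1 / 2 : ℝ) * ∑ l, (metricMatrix g p y)⁻¹ k l *
    (partialDeriv I i (fun z => metricMatrix g p z j l) y
      + partialDeriv I j (fun z => metricMatrix g p z i l) y
      - partialDeriv I l (fun z => metricMatrix g p z i j) y)

/-- The Laplace-Beltrami operator (the trace of the covariant Hessian)
`Δ_g u = ∑ᵢⱼ gⁱʲ (∂ᵢ ∂ⱼ u - ∑ₖ Γᵏᵢⱼ ∂ₖ u)` of a complex-valued function, at the point `x`,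
computed in the chart at `x`. -/
def laplaceBeltrami (g : RiemannianMetric I M) (u : M → ℂ) (x : M) : ℂ :=
  let y := extChartAt I x x
  let v : EuclideanSpace ℝ (Fin m) → ℂ := u ∘ (extChartAt I x).symm
  ∑ i, ∑ j, (metricMatrix g x y)⁻¹ i j •
    (partialDeriv I i (partialDeriv I j v) y
      - ∑ k, christoffel g x k i j y • partialDeriv I k v y)

/-- The differential `df` at `x` of a complex-valued function `f`. -/
def differential (I : ModelWithCorners ℝ (EuclideanSpace ℝ (Fin m)) H) (f : M → ℂ) (x : M) :
    TangentSpace I x →L[ℝ] ℂ :=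
  mfderiv I 𝓘(ℝ, ℂ) f x

/-- `f` is holomorphic in the interior of `M`: `df ∘ J = i df` at every interior point. -/
def IsHolomorphicInInterior (J : AlmostComplexStructure I M) (f : M → ℂ) : Prop :=
  ∀ x ∈ I.interior M, MDifferentiableAt I 𝓘(ℝ, ℂ) f x ∧
    ∀ v : TangentSpace I x,
      differential I f x (J.toFun x v) = Complex.I * differential I f x v

/-- `M` is holomorphically separable: points of `M` are separated by functions in `C^∞(M)`
that are holomorphic in the interior of `M`. -/
def HolomorphicallySeparable (J : AlmostComplexStructure I M) : Prop :=
  ∀ x y : M, x ≠ y → ∃ f : M → ℂ,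
    ContMDiff I 𝓘(ℝ, ℂ) ∞ f ∧ IsHolomorphicInInterior J f ∧ f x ≠ f y

end KahlerCalderon

end

/-! On a Kähler manifold, holomorphic and antiholomorphic functions are harmonic. For `u`, `h`
smooth and holomorphic in the interior, both `u` and `star h` are thus admissible, so `μ` kills
every product `u * star h`. Holomorphic functions are closed under multiplication, so these products
span the star subalgebra generated by them. It separates points by hypothesis, hence is dense by
Stone–Weierstrass, and continuity gives `μ = 0`.

The work lies in harmonicity, `laplaceBeltrami_eq_zero`, proved in coordinates for any solution of
`df ∘ J = c df` with `c ≠ 0`. Differentiating this equation and tracing with the inverse metric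
expresses `c gⁱʲ ∂ᵢ∂ⱼf` through `gⁱʲ ∂ᵢJᵏⱼ`, because the antisymmetric tensor `J g⁻¹` annihilates
the symmetric Hessian (`trace_hessian_eq_zero`). Closedness of the fundamental form identifies that
contraction with `J` applied to `gⁱʲ Γˡᵢⱼ` (`contraction_deriv_complexStructure`), which cancels the
Christoffel term of the Laplacian. -/

noncomputable section

namespace KahlerCalderon

/-! ### Pointwise matrix identities behind harmonicity -/

/-- Pointwise form of the identity `∑ᵢⱼ gⁱʲ (∇ᵢ J)ⱼ = 0` on an almost Kähler manifold: if the
fundamental form `Jᵀ g` is closed, then the contraction of `∂ J` equals `J` applied to the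
contraction of the Christoffel symbols. -/
lemma contraction_deriv_complexStructure {ι : Type*} [Fintype ι] [DecidableEq ι]
    {G J : Matrix ι ι ℝ} {dG dJ : ι → Matrix ι ι ℝ}
    (hdet : IsUnit G.det) (hG : G.transpose = G) (hJ : J * J = -1)
    (hGJ : J.transpose * G = -(G * J))
    (hdG : ∀ i, (dG i).transpose = dG i) (hdJ : ∀ i, dJ i * J = -(J * dJ i))
    (hanti : ∀ i, ((dJ i).transpose * G + J.transpose * dG i).transpose
      = -((dJ i).transpose * G + J.transpose * dG i))
    (hclosed : ∀ i j k,
      ((dJ i).transpose * G + J.transpose * dG i) j k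
      + ((dJ j).transpose * G + J.transpose * dG j) k i
      + ((dJ k).transpose * G + J.transpose * dG k) i j = 0) (k : ι) :
    ∑ i, ∑ j, G⁻¹ i j * dJ i k j
      = ∑ l, J k l * ∑ i, ∑ j, G⁻¹ i j * ((1 / 2 : ℝ) * ∑ p, G⁻¹ l p *
        (dG i j p + dG j i p - dG p i j)) := by
  set A := G⁻¹ with hA
  have hAG : A * G = 1 := Matrix.nonsing_inv_mul G hdet
  have hGA : G * A = 1 := Matrix.mul_nonsing_inv G hdet
  have hAT : A.transpose = A := by rw [hA, Matrix.transpose_nonsing_inv, hG]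
  have hAJ : A * J.transpose = -(J * A) := by
    calc A * J.transpose = A * (J.transpose * G) * A := by
          rw [Matrix.mul_assoc, Matrix.mul_assoc, hGA, Matrix.mul_one]
      _ = -(J * A) := by
          rw [hGJ, Matrix.mul_neg, ← Matrix.mul_assoc, hAG, Matrix.one_mul, Matrix.neg_mul]
  have hJJT : J.transpose * J.transpose = -1 := by
    rw [← Matrix.transpose_mul, hJ]; simp
  set dw : ι → Matrix ι ι ℝ := fun i => (dJ i).transpose * G + J.transpose * dG i with hdw
  have hdw' : ∀ i j k, dw i j k = - dw i k j := fun i j k => by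
    have := congrFun (congrFun (hanti i) k) j
    simpa [hdw] using this
  have hPanti : ∀ i j, (J * A) i j = -(J * A) j i := fun i j => by
    have h : (J * A).transpose = -(J * A) := by rw [Matrix.transpose_mul, hAT, hAJ]
    have := congrFun (congrFun h j) i
    simpa using this
  set W : ι → ℝ := fun k => ∑ i, ∑ j, A i j * dJ i k j with hW
  -- Here `dw i` is the derivative of the form matrix `Jᵀ G`; moving `Jᵀ` past `(dJ i)ᵀ` uses the
  -- differentiated relation `J² = -1`.
  have hPw : ∀ i, J * A * dw i = A * (dJ i).transpose * (J.transpose * G) + A * dG i := fun i => by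
    have h1 : J * A = -(A * J.transpose) := by rw [hAJ, neg_neg]
    have h2 : J.transpose * (dJ i).transpose = -((dJ i).transpose * J.transpose) := by
      rw [← Matrix.transpose_mul, hdJ, Matrix.transpose_neg, Matrix.transpose_mul]
    rw [h1, hdw]
    simp only [Matrix.mul_add, Matrix.neg_mul]
    congr 1
    · rw [← Matrix.mul_assoc, Matrix.mul_assoc A, h2]; simp [Matrix.mul_assoc]
    · rw [← Matrix.mul_assoc, Matrix.mul_assoc A, hJJT]; simp
  have hT1 : ∀ k, ∑ i, (J * A * dw i) i k
      = Matrix.vecMul W (J.transpose * G) k + ∑ i, (A * dG i) i k := fun k => by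
    simp_rw [hPw, Matrix.add_apply]
    rw [Finset.sum_add_distrib]
    congr 1
    simp_rw [Matrix.mul_apply (N := J.transpose * G), Matrix.vecMul, dotProduct]
    rw [Finset.sum_comm]
    refine Finset.sum_congr rfl fun p _ => ?_
    rw [← Finset.sum_mul]
    simp [hW, Matrix.mul_apply]
  have hT3 : ∀ k, ∑ i, ∑ j, (J * A) i j * dw k i j = -(A * dG k).trace := fun k => by
    have h0 : ∑ i, ∑ j, (J * A) i j * dw k i j = -(J * A * dw k).trace := by
      simp only [Matrix.trace, Matrix.diag, Matrix.mul_apply (M := J * A)]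
      simp only [← Finset.sum_neg_distrib]
      exact Finset.sum_congr rfl fun i _ => Finset.sum_congr rfl fun j _ => by
        rw [hdw' k i j, mul_neg]
    -- `dJ k` anticommutes with `J`, so this trace equals its own negative.
    have h2 : (dJ k * J).trace = 0 := by
      have h3 : (dJ k * J).trace = -(dJ k * J).trace := by
        conv_lhs => rw [hdJ, Matrix.trace_neg, Matrix.trace_mul_comm]
      linarith
    have h1 : (A * (dJ k).transpose * (J.transpose * G)).trace = 0 := by
      rw [Matrix.trace_mul_comm, Matrix.mul_assoc, ← Matrix.mul_assoc G, hGA, Matrix.one_mul,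
        ← Matrix.transpose_mul, Matrix.trace_transpose, h2]
    rw [h0, hPw, Matrix.trace_add, h1, zero_add]
  -- Contract the closedness relation with the antisymmetric `J * A`: the first two cyclic terms
  -- become equal and the third is `hT3`, whence the factor `1/2`.
  have hkey : ∀ k, Matrix.vecMul W (J.transpose * G) k
      = -(∑ i, (A * dG i) i k - (1 / 2 : ℝ) * (A * dG k).trace) := fun k => by
    have hs : ∑ i, ∑ j, (J * A) i j * (dw i j k + dw j k i + dw k i j) = 0 :=
      Finset.sum_eq_zero fun i _ => Finset.sum_eq_zero fun j _ => by
        rw [show dw i j k + dw j k i + dw k i j = 0 from hclosed i j k, mul_zero]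
    simp_rw [mul_add, Finset.sum_add_distrib] at hs
    have e1 : ∑ i, ∑ j, (J * A) i j * dw i j k = ∑ i, (J * A * dw i) i k := by
      simp [Matrix.mul_apply (M := J * A)]
    have e2 : ∑ i, ∑ j, (J * A) i j * dw j k i = ∑ i, (J * A * dw i) i k := by
      rw [← e1, Finset.sum_comm]
      refine Finset.sum_congr rfl fun i _ => Finset.sum_congr rfl fun j _ => ?_
      rw [hPanti j i, hdw' i k j]; ring
    rw [e1, e2, hT3, hT1] at hs
    linarith
  set γ : ι → ℝ := fun k => ∑ i, (A * dG i) i k - (1 / 2 : ℝ) * (A * dG k).trace with hγ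
  have hWγ : W = J.mulVec (A.mulVec γ) := by
    have h1 : Matrix.vecMul W (J.transpose * G) = -γ := funext hkey
    -- The form matrix has inverse `J * A`, so `hkey` can be solved for `W`.
    have h2 : J.transpose * G * (J * A) = 1 := by
      rw [hGJ, Matrix.neg_mul, Matrix.mul_assoc, ← Matrix.mul_assoc J, hJ]
      simp [hGA]
    calc W = Matrix.vecMul (Matrix.vecMul W (J.transpose * G)) (J * A) := by
          rw [Matrix.vecMul_vecMul, h2, Matrix.vecMul_one]
      _ = Matrix.vecMul γ (A * J.transpose) := by
          rw [h1, hAJ, Matrix.neg_vecMul, Matrix.vecMul_neg]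
      _ = J.mulVec (A.mulVec γ) := by
          rw [Matrix.mulVec_mulVec, ← Matrix.vecMul_transpose, Matrix.transpose_mul, hAT]
  -- `γ` is the `g⁻¹`-trace of the Christoffel symbols with lowered upper index.
  have hγ' : ∀ p, γ p = ∑ i, ∑ j, A i j * ((1 / 2 : ℝ) * (dG i j p + dG j i p - dG p i j)) :=
    fun p => by
    have hAs : ∀ i j, A i j = A j i := fun i j => congrFun (congrFun hAT j) i
    have hds : ∀ k i j, dG k i j = dG k j i := fun k i j => congrFun (congrFun (hdG k) j) i
    have e1 : ∑ i, ∑ j, A i j * dG j i p = ∑ i, ∑ j, A i j * dG i j p := by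
      rw [Finset.sum_comm]
      exact Finset.sum_congr rfl fun i _ => Finset.sum_congr rfl fun j _ => by rw [hAs]
    have e2 : (A * dG p).trace = ∑ i, ∑ j, A i j * dG p i j := by
      simp only [Matrix.trace, Matrix.diag, Matrix.mul_apply]
      exact Finset.sum_congr rfl fun i _ => Finset.sum_congr rfl fun j _ => by rw [hds]
    have e3 : ∑ i, (A * dG i) i p = ∑ i, ∑ j, A i j * dG i j p := by simp [Matrix.mul_apply]
    have e4 : ∑ i, ∑ j, A i j * ((1 / 2 : ℝ) * (dG i j p + dG j i p - dG p i j))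
        = (1 / 2 : ℝ) * (∑ i, ∑ j, A i j * dG i j p + ∑ i, ∑ j, A i j * dG j i p
          - ∑ i, ∑ j, A i j * dG p i j) := by
      simp only [← Finset.sum_add_distrib, ← Finset.sum_sub_distrib, Finset.mul_sum]
      exact Finset.sum_congr rfl fun i _ => Finset.sum_congr rfl fun j _ => by ring
    rw [e4, e1, hγ]
    simp only [e2, e3]
    ring
  change W k = _
  rw [hWγ]
  simp only [Matrix.mulVec, dotProduct]
  refine Finset.sum_congr rfl fun l _ => ?_
  congr 1
  simp_rw [hγ', Finset.mul_sum]
  rw [Finset.sum_comm]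
  refine Finset.sum_congr rfl fun i _ => ?_
  rw [Finset.sum_comm]
  refine Finset.sum_congr rfl fun j _ => Finset.sum_congr rfl fun p _ => ?_
  ring

/-- Pointwise form of the harmonicity of (anti)holomorphic functions: `a` is the differential and
`S` the second derivative of a function whose differential satisfies `a ∘ J = c a`. -/
lemma trace_hessian_eq_zero {ι : Type*} [Fintype ι]
    {A J : Matrix ι ι ℝ} {dJ : ι → Matrix ι ι ℝ} {Γ : ι → ι → ι → ℝ} {c : ℂ} (hc : c ≠ 0)
    (hAJ : A * J.transpose = -(J * A)) (hAT : A.transpose = A)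
    (hcontr : ∀ k, ∑ i, ∑ j, A i j * dJ i k j = ∑ l, J k l * ∑ i, ∑ j, A i j * Γ l i j)
    {a : ι → ℂ} {S : ι → ι → ℂ} (hS : ∀ i j, S i j = S j i)
    (ha : ∀ j, ∑ k, (J k j : ℂ) * a k = c * a j)
    (hda : ∀ i j, ∑ k, ((dJ i k j : ℂ) * a k + (J k j : ℂ) * S i k) = c * S i j) :
    ∑ i, ∑ j, A i j • (S i j - ∑ k, Γ k i j • a k) = 0 := by
  have hanti : ∀ i k, (J * A) k i = -(J * A) i k := fun i k => by
    have h : (J * A).transpose = -(J * A) := by rw [Matrix.transpose_mul, hAT, hAJ]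
    have := congrFun (congrFun h i) k
    simpa using this
  -- An antisymmetric tensor paired with the symmetric Hessian vanishes.
  have h0 : ∑ i, ∑ k, ((J * A) k i : ℂ) * S i k = 0 := by
    have h1 : ∑ i, ∑ k, ((J * A) k i : ℂ) * S i k = -∑ i, ∑ k, ((J * A) k i : ℂ) * S i k := by
      conv_lhs => rw [Finset.sum_comm]
      simp only [← Finset.sum_neg_distrib]
      refine Finset.sum_congr rfl fun i _ => Finset.sum_congr rfl fun k _ => ?_
      rw [hanti k i, hS k i]; push_cast; ring
    exact self_eq_neg.mp h1
  have hAs : ∀ i j, A i j = A j i := fun i j => congrFun (congrFun hAT j) i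
  have e1 : ∑ i, ∑ j, (A i j : ℂ) * ∑ k, (J k j : ℂ) * S i k = 0 := by
    rw [← h0]
    refine Finset.sum_congr rfl fun i _ => ?_
    simp_rw [Finset.mul_sum]
    rw [Finset.sum_comm]
    refine Finset.sum_congr rfl fun k _ => ?_
    rw [Matrix.mul_apply]; push_cast; rw [Finset.sum_mul]
    refine Finset.sum_congr rfl fun j _ => ?_
    rw [hAs]; ring
  have e2 : ∑ i, ∑ j, (A i j : ℂ) * ∑ k, (dJ i k j : ℂ) * a k
      = ∑ k, ((∑ i, ∑ j, A i j * dJ i k j : ℝ) : ℂ) * a k := by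
    push_cast
    simp_rw [Finset.mul_sum, Finset.sum_mul]
    rw [Finset.sum_comm' (t' := Finset.univ) (s' := fun _ => Finset.univ) (by simp)]
    conv_rhs => rw [Finset.sum_comm]
    rw [Finset.sum_comm]
    refine Finset.sum_congr rfl fun i _ => ?_
    rw [Finset.sum_comm]
    refine Finset.sum_congr rfl fun j _ => Finset.sum_congr rfl fun k _ => ?_
    ring
  -- `hcontr` puts `J` on the contracted Christoffel vector `b`; pairing with `a` and using `a ∘ J =
  -- c a` trades it for the factor `c`, cancelled at the end.
  have e3 : ∑ k, ((∑ i, ∑ j, A i j * dJ i k j : ℝ) : ℂ) * a k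
      = c * ∑ l, ((∑ i, ∑ j, A i j * Γ l i j : ℝ) : ℂ) * a l := by
    generalize hb : (fun l => ∑ i, ∑ j, A i j * Γ l i j) = b at *
    replace hcontr : ∀ k, ∑ i, ∑ j, A i j * dJ i k j = ∑ l, J k l * b l := by
      simpa [← hb] using hcontr
    have hb' : ∀ l, ∑ i, ∑ j, A i j * Γ l i j = b l := fun l => by rw [← hb]
    simp_rw [hcontr, hb']
    rw [Finset.mul_sum]
    simp_rw [Complex.ofReal_sum, Finset.sum_mul]
    rw [Finset.sum_comm]
    refine Finset.sum_congr rfl fun l _ => ?_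
    rw [mul_left_comm, ← ha, Finset.mul_sum]
    refine Finset.sum_congr rfl fun k _ => ?_
    push_cast; ring
  have e4 : ∑ i, ∑ j, (A i j : ℂ) * (c * S i j)
      = c * ∑ l, ((∑ i, ∑ j, A i j * Γ l i j : ℝ) : ℂ) * a l := by
    rw [← e3, ← e2, ← add_zero (∑ i, ∑ j, _ * ∑ k, (dJ i k j : ℂ) * a k), ← e1,
      ← Finset.sum_add_distrib]
    refine Finset.sum_congr rfl fun i _ => ?_
    rw [← Finset.sum_add_distrib]
    refine Finset.sum_congr rfl fun j _ => ?_
    rw [← hda, Finset.sum_add_distrib, mul_add]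
  apply mul_left_cancel₀ hc
  rw [mul_zero]
  have e5 : ∑ l, ((∑ i, ∑ j, A i j * Γ l i j : ℝ) : ℂ) * a l
      = ∑ i, ∑ j, (A i j : ℂ) * ∑ k, (Γ k i j : ℂ) * a k := by
    push_cast
    simp_rw [Finset.mul_sum, Finset.sum_mul]
    rw [Finset.sum_comm]
    refine Finset.sum_congr rfl fun i _ => ?_
    rw [Finset.sum_comm]
    refine Finset.sum_congr rfl fun j _ => Finset.sum_congr rfl fun k _ => ?_
    ring
  rw [e5] at e4
  simp only [Complex.real_smul, mul_sub, Finset.sum_sub_distrib]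
  rw [← e4, sub_eq_zero, Finset.mul_sum]
  refine Finset.sum_congr rfl fun i _ => ?_
  rw [Finset.mul_sum]
  exact Finset.sum_congr rfl fun j _ => by ring

/-! ### The metric, complex structure and fundamental form as smooth matrices in a chart -/

section Coordinates

variable {m : ℕ} {H : Type*} [TopologicalSpace H]
  {I : ModelWithCorners ℝ (EuclideanSpace ℝ (Fin m)) H}
  {M : Type*} [TopologicalSpace M] [ChartedSpace H M] [IsManifold I ∞ M]

/-- The entries `Jᵏᵢ` of the complex structure in the chart at `p`. -/
def structureMatrix (J : AlmostComplexStructure I M) (p : M) (y : EuclideanSpace ℝ (Fin m)) :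
    Matrix (Fin m) (Fin m) ℝ :=
  Matrix.of fun k i =>
    (trivializationAt (EuclideanSpace ℝ (Fin m)) (TangentSpace I) p).continuousLinearMapAt ℝ
      ((extChartAt I p).symm y) (J.toFun ((extChartAt I p).symm y) (coordField I p i y)) k

lemma contMDiffOn_symmL_trivializationAt (p : M) (v : EuclideanSpace ℝ (Fin m)) :
    ContMDiffOn I I.tangent ∞
      (fun x => (⟨x, (trivializationAt (EuclideanSpace ℝ (Fin m)) (TangentSpace I) p).symmL ℝ x
        v⟩ : TangentBundle I M)) (chartAt H p).source := by
  rw [← TangentBundle.trivializationAt_baseSet (I := I),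
    Bundle.Trivialization.contMDiffOn_section_baseSet_iff]
  exact (contMDiffOn_const (c := v)).congr fun x hx => by
    rw [Bundle.Trivialization.symmL_apply _ hx, Bundle.Trivialization.apply_mk_symm _ hx]

omit [IsManifold I ∞ M] in
lemma extChartAt_symm_mem_chartAt_source (p : M) {y : EuclideanSpace ℝ (Fin m)}
    (hy : y ∈ (extChartAt I p).target) : (extChartAt I p).symm y ∈ (chartAt H p).source := by
  rw [← extChartAt_source I]; exact (extChartAt I p).map_target hy

/-- Identifies the coordinate fields with the local frame of the tangent bundle trivialization, from
which smoothness of matrix entries and uniqueness of components follow. -/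
lemma coordField_eq (p : M) (i : Fin m) {y : EuclideanSpace ℝ (Fin m)}
    (hy : y ∈ (extChartAt I p).target) :
    coordField I p i y
      = (trivializationAt (EuclideanSpace ℝ (Fin m)) (TangentSpace I) p).symmL ℝ
        ((extChartAt I p).symm y) (EuclideanSpace.single i (1 : ℝ)) := by
  have : IsManifold I 1 M := IsManifold.of_le (n := ∞) (by simp)
  rw [TangentBundle.symmL_trivializationAt (extChartAt_symm_mem_chartAt_source p hy),
    (extChartAt I p).right_inv hy]
  rfl

lemma contDiffOn_comp_extChartAt_symm {F : Type*} [NormedAddCommGroup F] [NormedSpace ℝ F] (p : M)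
    {f : M → F} (hf : ContMDiffOn I 𝓘(ℝ, F) ∞ f (chartAt H p).source) :
    ContDiffOn ℝ ∞ (f ∘ (extChartAt I p).symm) (extChartAt I p).target :=
  (hf.comp (contMDiffOn_extChartAt_symm p)
    fun _ hy => extChartAt_symm_mem_chartAt_source p hy).contDiffOn

lemma contDiffOn_metricMatrix (g : RiemannianMetric I M) (p : M) (i j : Fin m) :
    ContDiffOn ℝ ∞ (fun z => metricMatrix g p z i j) (extChartAt I p).target := by
  have h : ContMDiffOn I 𝓘(ℝ, ℝ) ∞ (fun x => g.inner x
      ((trivializationAt (EuclideanSpace ℝ (Fin m)) (TangentSpace I) p).symmL ℝ x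
        (EuclideanSpace.single i (1 : ℝ)))
      ((trivializationAt (EuclideanSpace ℝ (Fin m)) (TangentSpace I) p).symmL ℝ x
        (EuclideanSpace.single j (1 : ℝ)))) (chartAt H p).source := fun x hx => by
    have h' := ContMDiffWithinAt.clm_bundle_apply₂ (F₃ := ℝ) (E₃ := Bundle.Trivial M ℝ)
      (b := fun x : M => x) (g.contMDiff x).contMDiffWithinAt
      (contMDiffOn_symmL_trivializationAt p (EuclideanSpace.single i (1 : ℝ)) x hx)
      (contMDiffOn_symmL_trivializationAt p (EuclideanSpace.single j (1 : ℝ)) x hx)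
    exact (Bundle.contMDiffWithinAt_totalSpace.mp h').2
  refine (contDiffOn_comp_extChartAt_symm p h).congr fun y hy => ?_
  simp only [metricMatrix, Matrix.of_apply, coordField_eq p _ hy]
  rfl

lemma contDiffOn_structureMatrix (J : AlmostComplexStructure I M) (p : M) (k i : Fin m) :
    ContDiffOn ℝ ∞ (fun z => structureMatrix J p z k i) (extChartAt I p).target := by
  set e := trivializationAt (EuclideanSpace ℝ (Fin m)) (TangentSpace I) p with he
  have h1 : ContMDiffOn I I.tangent ∞ (fun x => (⟨x, J.toFun x (e.symmL ℝ x
        (EuclideanSpace.single i (1 : ℝ)))⟩ : TangentBundle I M)) (chartAt H p).source :=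
    ContMDiffOn.clm_bundle_apply (b := id) J.contMDiff.contMDiffOn
      (contMDiffOn_symmL_trivializationAt p (EuclideanSpace.single i (1 : ℝ)))
  rw [← TangentBundle.trivializationAt_baseSet (I := I),
    Bundle.Trivialization.contMDiffOn_section_baseSet_iff,
    TangentBundle.trivializationAt_baseSet] at h1
  have h2 := contDiffOn_comp_extChartAt_symm p h1
  refine ((EuclideanSpace.proj (𝕜 := ℝ) k).contDiff.comp_contDiffOn h2).congr fun y hy => ?_
  have hx := extChartAt_symm_mem_chartAt_source p hy
  simp only [structureMatrix, Matrix.of_apply, coordField_eq p _ hy]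
  rw [Bundle.Trivialization.continuousLinearMapAt_apply, e.linearMapAt_def_of_mem]
  · rfl
  · rwa [he, TangentBundle.trivializationAt_baseSet]

/-- A tangent vector is the combination of the coordinate fields with its chart components. -/
lemma eq_sum_coordField (p : M) {y : EuclideanSpace ℝ (Fin m)} (hy : y ∈ (extChartAt I p).target)
    (v : TangentSpace I ((extChartAt I p).symm y)) :
    v = ∑ k, ((trivializationAt (EuclideanSpace ℝ (Fin m)) (TangentSpace I) p
      ).continuousLinearMapAt ℝ ((extChartAt I p).symm y) v) k • coordField I p k y := by
  set e := trivializationAt (EuclideanSpace ℝ (Fin m)) (TangentSpace I) p with he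
  have hx : (extChartAt I p).symm y ∈ e.baseSet := by
    rw [he, TangentBundle.trivializationAt_baseSet]; exact extChartAt_symm_mem_chartAt_source p hy
  simp only [coordField_eq p _ hy, ← he]
  conv_lhs => rw [← e.symmL_continuousLinearMapAt (R := ℝ) hx v]
  set w := e.continuousLinearMapAt ℝ ((extChartAt I p).symm y) v
  conv_lhs => rw [show w = ∑ k, w k • EuclideanSpace.single k (1 : ℝ) by
    simpa using ((EuclideanSpace.basisFun (Fin m) ℝ).toBasis.sum_repr w).symm]
  simp only [map_sum, map_smul]

lemma structure_coordField (J : AlmostComplexStructure I M) (p : M) (i : Fin m)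
    {y : EuclideanSpace ℝ (Fin m)} (hy : y ∈ (extChartAt I p).target) :
    J.toFun ((extChartAt I p).symm y) (coordField I p i y)
      = ∑ k, structureMatrix J p y k i • coordField I p k y :=
  eq_sum_coordField p hy _

lemma coordField_coord (p : M) (i k : Fin m) {y : EuclideanSpace ℝ (Fin m)}
    (hy : y ∈ (extChartAt I p).target) :
    ((trivializationAt (EuclideanSpace ℝ (Fin m)) (TangentSpace I) p
      ).continuousLinearMapAt ℝ ((extChartAt I p).symm y) (coordField I p i y)) k
      = (1 : Matrix (Fin m) (Fin m) ℝ) k i := by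
  rw [coordField_eq p _ hy, Bundle.Trivialization.continuousLinearMapAt_symmL]
  · simp [Matrix.one_apply]
  · rw [TangentBundle.trivializationAt_baseSet]; exact extChartAt_symm_mem_chartAt_source p hy

lemma structureMatrix_mul_self (J : AlmostComplexStructure I M) (p : M)
    {y : EuclideanSpace ℝ (Fin m)} (hy : y ∈ (extChartAt I p).target) :
    structureMatrix J p y * structureMatrix J p y = -1 := by
  ext k i
  have h := J.sq_eq_neg _ (coordField I p i y)
  rw [structure_coordField J p i hy] at h
  replace h := congrArg (fun v => ((trivializationAt (EuclideanSpace ℝ (Fin m)) (TangentSpace I) p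
      ).continuousLinearMapAt ℝ ((extChartAt I p).symm y) v) k) h
  simp only [map_sum, map_smul, map_neg, PiLp.neg_apply, coordField_coord p _ _ hy] at h
  rw [Matrix.neg_apply, ← h, Matrix.mul_apply]
  simp [structureMatrix, mul_comm]

lemma transpose_metricMatrix (g : RiemannianMetric I M) (p : M) (y : EuclideanSpace ℝ (Fin m)) :
    (metricMatrix g p y).transpose = metricMatrix g p y := by
  ext i j
  exact g.symm _ _ _

/-- A kernel vector `v` would be the components of a nonzero tangent vector `w` with `g(w, w) = vᵀ G
v = 0`, against positivity. -/
lemma isUnit_det_metricMatrix (g : RiemannianMetric I M) (p : M)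
    {y : EuclideanSpace ℝ (Fin m)} (hy : y ∈ (extChartAt I p).target) :
    IsUnit (metricMatrix g p y).det := by
  rw [isUnit_iff_ne_zero]
  intro h0
  obtain ⟨v, hv, hv0⟩ := Matrix.exists_mulVec_eq_zero_iff.mpr h0
  set w : TangentSpace I ((extChartAt I p).symm y) := ∑ k, v k • coordField I p k y with hw
  have hvw : ∀ k, ((trivializationAt (EuclideanSpace ℝ (Fin m)) (TangentSpace I) p
      ).continuousLinearMapAt ℝ ((extChartAt I p).symm y) w) k = v k := fun k => by
    simp only [hw, map_sum, map_smul, PiLp.smul_apply, WithLp.ofLp_sum, Finset.sum_apply,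
      coordField_coord p _ _ hy]
    simp [Matrix.one_apply]
  have hw0 : w ≠ 0 := fun h => hv (funext fun k => by rw [← hvw k, h, map_zero]; rfl)
  have hpos := g.pos _ w hw0
  have : g.inner _ w w = ∑ i, v i * (metricMatrix g p y).mulVec v i := by
    simp only [Matrix.mulVec, dotProduct, metricMatrix, Matrix.of_apply, Finset.mul_sum]
    conv_lhs => rw [hw]
    simp only [map_sum, map_smul, sum_apply, smul_apply, smul_eq_mul, Finset.mul_sum]
    rw [Finset.sum_comm]
    exact Finset.sum_congr rfl fun i _ => Finset.sum_congr rfl fun j _ => by ring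
  rw [this, hv0] at hpos
  simp at hpos

lemma fundamentalForm_eq (g : RiemannianMetric I M) (J : AlmostComplexStructure I M) (p : M)
    (i j : Fin m) {y : EuclideanSpace ℝ (Fin m)} (hy : y ∈ (extChartAt I p).target) :
    fundamentalForm g J p i j y
      = ((structureMatrix J p y).transpose * metricMatrix g p y) i j := by
  rw [fundamentalForm, structure_coordField J p i hy]
  simp only [map_sum, map_smul, sum_apply, smul_apply, smul_eq_mul, Matrix.mul_apply,
    metricMatrix, Matrix.of_apply, Matrix.transpose_apply]

/-- Matrix form of `g(JX, Y) = g(J²X, JY) = -g(X, JY)`. -/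
lemma transpose_structureMatrix_mul_metricMatrix (g : RiemannianMetric I M)
    (J : AlmostComplexStructure I M)
    (hherm : ∀ (x : M) (v w : TangentSpace I x),
      g.inner x (J.toFun x v) (J.toFun x w) = g.inner x v w) (p : M)
    {y : EuclideanSpace ℝ (Fin m)} (hy : y ∈ (extChartAt I p).target) :
    (structureMatrix J p y).transpose * metricMatrix g p y
      = -(metricMatrix g p y * structureMatrix J p y) := by
  ext i j
  rw [← fundamentalForm_eq g J p i j hy, fundamentalForm, ← hherm, J.sq_eq_neg,
    structure_coordField J p j hy]
  simp only [map_sum, map_smul, map_neg, neg_apply, smul_eq_mul, Matrix.mul_apply,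
    metricMatrix, Matrix.of_apply, Matrix.neg_apply, mul_comm, mul_neg, Finset.sum_neg_distrib]

end Coordinates

/-! ### Partial derivatives up to the boundary, and harmonicity -/

section Derivatives

variable {m : ℕ} {H : Type*} [TopologicalSpace H]
  {I : ModelWithCorners ℝ (EuclideanSpace ℝ (Fin m)) H}
  {M : Type*} [TopologicalSpace M] [ChartedSpace H M]
  {F : Type*} [NormedAddCommGroup F] [NormedSpace ℝ F]

/-- The chart target is a neighbourhood of each of its points within `Set.range I`, the set in which
`partialDeriv` differentiates. -/
lemma ContDiffOn.contDiffWithinAt_range {p : M} {f : EuclideanSpace ℝ (Fin m) → F}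
    (hf : ContDiffOn ℝ ∞ f (extChartAt I p).target) {y : EuclideanSpace ℝ (Fin m)}
    (hy : y ∈ (extChartAt I p).target) : ContDiffWithinAt ℝ ∞ f (Set.range I) y :=
  (hf y hy).mono_of_mem_nhdsWithin (extChartAt_target_mem_nhdsWithin_of_mem hy)

lemma partialDeriv_congr {p : M} {f h : EuclideanSpace ℝ (Fin m) → F}
    (hfh : Set.EqOn f h (extChartAt I p).target) (i : Fin m) {y : EuclideanSpace ℝ (Fin m)}
    (hy : y ∈ (extChartAt I p).target) : partialDeriv I i f y = partialDeriv I i h y := by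
  have : f =ᶠ[nhdsWithin y (Set.range I)] h :=
    Filter.eventuallyEq_of_mem (extChartAt_target_mem_nhdsWithin_of_mem hy) hfh
  rw [partialDeriv, partialDeriv, this.fderivWithin_eq (hfh hy)]

lemma contDiffWithinAt_partialDeriv (i : Fin m) {f : EuclideanSpace ℝ (Fin m) → F}
    {y : EuclideanSpace ℝ (Fin m)} (hf : ContDiffWithinAt ℝ ∞ f (Set.range I) y)
    (hy : y ∈ Set.range I) : ContDiffWithinAt ℝ ∞ (partialDeriv I i f) (Set.range I) y :=
  (hf.fderivWithin_right I.uniqueDiffOn (by simp) hy).clm_apply contDiffWithinAt_const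

/-- Symmetry of second derivatives persists at boundary points because `Set.range I` lies in the
closure of its interior. -/
lemma partialDeriv_comm (i j : Fin m) {f : EuclideanSpace ℝ (Fin m) → F}
    {y : EuclideanSpace ℝ (Fin m)} (hf : ContDiffWithinAt ℝ ∞ f (Set.range I) y)
    (hy : y ∈ Set.range I) :
    partialDeriv I i (partialDeriv I j f) y = partialDeriv I j (partialDeriv I i f) y := by
  have h1 : DifferentiableWithinAt ℝ (fderivWithin ℝ f (Set.range I)) (Set.range I) y :=
    (hf.fderivWithin_right (m := ∞) I.uniqueDiffOn (by simp) hy).differentiableWithinAt (by simp)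
  have h2 : ∀ i j, partialDeriv I i (partialDeriv I j f) y
      = fderivWithin ℝ (fderivWithin ℝ f (Set.range I)) (Set.range I) y
        (EuclideanSpace.single i (1 : ℝ)) (EuclideanSpace.single j (1 : ℝ)) := fun i j => by
    have h3 := (h1.hasFDerivWithinAt.clm_apply (hasFDerivWithinAt_const
      (EuclideanSpace.single j (1 : ℝ)) y (Set.range I))).fderivWithin
        (I.uniqueDiffOn y hy)
    unfold partialDeriv
    rw [h3]
    simp
  rw [h2, h2]
  exact hf.isSymmSndFDerivWithinAt (by simpa using ENat.LEInfty.out) I.uniqueDiffOn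
    (I.range_subset_closure_interior hy) hy _ _

lemma partialDeriv_sum_smul {ι : Type*} [Fintype ι] (i : Fin m)
    {f : ι → EuclideanSpace ℝ (Fin m) → ℝ} {h : ι → EuclideanSpace ℝ (Fin m) → F}
    {y : EuclideanSpace ℝ (Fin m)} (hf : ∀ k, DifferentiableWithinAt ℝ (f k) (Set.range I) y)
    (hh : ∀ k, DifferentiableWithinAt ℝ (h k) (Set.range I) y) (hy : y ∈ Set.range I) :
    partialDeriv I i (fun z => ∑ k, f k z • h k z) y
      = ∑ k, (partialDeriv I i (f k) y • h k y + f k y • partialDeriv I i (h k) y) := by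
  have h3 := (HasFDerivWithinAt.fun_sum (u := Finset.univ) fun k _ =>
    (hf k).hasFDerivWithinAt.fun_smul (hh k).hasFDerivWithinAt).fderivWithin (I.uniqueDiffOn y hy)
  unfold partialDeriv
  rw [h3]
  simp [add_comm]

lemma partialDeriv_comp_extChartAt_symm [IsManifold I ∞ M] (p : M) (i : Fin m) {f : M → F}
    (hf : ContMDiff I 𝓘(ℝ, F) ∞ f) {y : EuclideanSpace ℝ (Fin m)}
    (hy : y ∈ (extChartAt I p).target) :
    partialDeriv I i (f ∘ (extChartAt I p).symm) y
      = mfderiv I 𝓘(ℝ, F) f ((extChartAt I p).symm y) (coordField I p i y) := by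
  have : IsManifold I 1 M := IsManifold.of_le (n := ∞) (by simp)
  have hyr := extChartAt_target_subset_range p hy
  have h := mfderiv_comp_mfderivWithin (I := 𝓘(ℝ, EuclideanSpace ℝ (Fin m))) y
    (hf.mdifferentiable (by simp) ((extChartAt I p).symm y))
    (mdifferentiableWithinAt_extChartAt_symm (I := I) hy)
    (I.uniqueDiffOn.uniqueMDiffOn y hyr)
  rw [mfderivWithin_eq_fderivWithin] at h
  rw [partialDeriv, h]
  rfl

/-- The equation `df ∘ J = c df` in the interior extends to the boundary, in coordinates. -/
lemma sum_structureMatrix_smul_partialDeriv [IsManifold I ∞ M] (J : AlmostComplexStructure I M)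
    {f : M → ℂ} (hf : ContMDiff I 𝓘(ℝ, ℂ) ∞ f) {c : ℂ}
    (hJ : ∀ x ∈ I.interior M, ∀ v : TangentSpace I x,
      differential I f x (J.toFun x v) = c * differential I f x v) (p : M) (j : Fin m) :
    Set.EqOn (fun y => ∑ k, structureMatrix J p y k j •
        partialDeriv I k (f ∘ (extChartAt I p).symm) y)
      (fun y => c * partialDeriv I j (f ∘ (extChartAt I p).symm) y) (extChartAt I p).target := by
  have : IsManifold I 1 M := IsManifold.of_le (n := ∞) (by simp)
  have hcont : ∀ k, ContinuousOn (partialDeriv I k (f ∘ (extChartAt I p).symm))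
      (extChartAt I p).target := fun k y hy =>
    (contDiffWithinAt_partialDeriv k (ContDiffOn.contDiffWithinAt_range
      (contDiffOn_comp_extChartAt_symm p hf.contMDiffOn) hy)
      (extChartAt_target_subset_range p hy)).continuousWithinAt.mono
      (extChartAt_target_subset_range p)
  -- Both sides are continuous on the chart target, which lies in the closure of its interior;
  -- points of that interior correspond to interior points of `M`.
  refine Set.EqOn.of_subset_closure (s := interior (extChartAt I p).target) ?_
    (continuousOn_finsetSum _ fun k _ =>
      (contDiffOn_structureMatrix J p k j).continuousOn.smul (hcont k))
    (continuousOn_const.mul (hcont j)) interior_subset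
    (fun y hy => extChartAt_target_subset_closure_interior hy)
  intro y hy
  have hyt := interior_subset hy
  have hint : (extChartAt I p).symm y ∈ I.interior M := by
    refine (I.isInteriorPoint_iff_of_mem_atlas (n := ∞) (by simp) (chart_mem_atlas H p)
      (extChartAt_symm_mem_chartAt_source p hyt)).mpr ?_
    rw [← extChartAt, (extChartAt I p).right_inv hyt]
    exact hy
  have h := hJ _ hint (coordField I p j y)
  rw [structure_coordField J p j hyt] at h
  simp only [partialDeriv_comp_extChartAt_symm p _ hf hyt]
  rw [map_sum] at h
  simp only [map_smul] at h
  exact h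

/-- Keeping `c` general treats the holomorphic case `c = i` and the antiholomorphic case `c = -i`
together. The conclusion includes boundary points, since the coordinate equation has been extended
there. -/
lemma laplaceBeltrami_eq_zero [IsManifold I ∞ M] {g : RiemannianMetric I M}
    {J : AlmostComplexStructure I M} (hK : IsKahler g J)
    {f : M → ℂ} (hf : ContMDiff I 𝓘(ℝ, ℂ) ∞ f) {c : ℂ} (hc : c ≠ 0)
    (hJ : ∀ x ∈ I.interior M, ∀ v : TangentSpace I x,
      differential I f x (J.toFun x v) = c * differential I f x v) (p : M) :
    laplaceBeltrami g f p = 0 := by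
  have hy : extChartAt I p p ∈ (extChartAt I p).target := mem_extChartAt_target p
  unfold laplaceBeltrami
  set y := extChartAt I p p
  set u : EuclideanSpace ℝ (Fin m) → ℂ := f ∘ (extChartAt I p).symm with hu
  have hyr := extChartAt_target_subset_range p hy
  have hG := fun i j => (ContDiffOn.contDiffWithinAt_range
    (contDiffOn_metricMatrix g p i j) hy).differentiableWithinAt (by simp)
  have hS := fun k i => (ContDiffOn.contDiffWithinAt_range
    (contDiffOn_structureMatrix J p k i) hy).differentiableWithinAt (by simp)
  have hu0 : ContDiffWithinAt ℝ ∞ u (Set.range I) y := ContDiffOn.contDiffWithinAt_range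
    (contDiffOn_comp_extChartAt_symm p hf.contMDiffOn) hy
  have hu1 := fun k => (contDiffWithinAt_partialDeriv (I := I) k hu0 hyr).differentiableWithinAt
    (by simp)
  set dG : Fin m → Matrix (Fin m) (Fin m) ℝ := fun i =>
    Matrix.of fun j l => partialDeriv I i (fun z => metricMatrix g p z j l) y with hdG
  set dJ : Fin m → Matrix (Fin m) (Fin m) ℝ := fun i =>
    Matrix.of fun k j => partialDeriv I i (fun z => structureMatrix J p z k j) y with hdJ
  -- Product rule for the form matrix `Jᵀ G`.
  have hω : ∀ i j k, ((dJ i).transpose * metricMatrix g p y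
      + (structureMatrix J p y).transpose * dG i) j k
      = partialDeriv I i (fundamentalForm g J p j k) y := fun i j k => by
    rw [partialDeriv_congr (fun z hz => fundamentalForm_eq g J p j k hz) i hy]
    simp only [Matrix.mul_apply, Matrix.transpose_apply, Matrix.add_apply]
    simp only [← smul_eq_mul (α := ℝ)]
    rw [partialDeriv_sum_smul i (fun l => hS l j) (fun l => hG l k) hyr, Finset.sum_add_distrib]
    rfl
  have hT := transpose_metricMatrix g p y
  have hJG := transpose_structureMatrix_mul_metricMatrix g J hK.hermitian p hy
  have hdet := isUnit_det_metricMatrix g p hy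
  have hAT : (metricMatrix g p y)⁻¹.transpose = (metricMatrix g p y)⁻¹ := by
    rw [Matrix.transpose_nonsing_inv, hT]
  have hAJ : (metricMatrix g p y)⁻¹ * (structureMatrix J p y).transpose
      = -(structureMatrix J p y * (metricMatrix g p y)⁻¹) := by
    calc (metricMatrix g p y)⁻¹ * (structureMatrix J p y).transpose
        = (metricMatrix g p y)⁻¹ * ((structureMatrix J p y).transpose * metricMatrix g p y)
          * (metricMatrix g p y)⁻¹ := by
          rw [Matrix.mul_assoc, Matrix.mul_assoc, Matrix.mul_nonsing_inv _ hdet, Matrix.mul_one]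
      _ = _ := by
          rw [hJG, Matrix.mul_neg, ← Matrix.mul_assoc, Matrix.nonsing_inv_mul _ hdet,
            Matrix.one_mul, Matrix.neg_mul]
  refine trace_hessian_eq_zero hc hAJ hAT (dJ := dJ) (fun k => ?_)
    (fun i j => partialDeriv_comm i j hu0 hyr) (fun j => ?_) (fun i j => ?_)
  · refine contraction_deriv_complexStructure hdet hT (structureMatrix_mul_self J p hy) hJG
      (dG := dG) (fun i => ?_) (fun i => ?_) (fun i => ?_) (fun i j k => ?_) k
    · ext j l
      exact partialDeriv_congr (p := p)
        (fun z _ => congrFun (congrFun (transpose_metricMatrix g p z) j) l) i hy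
    · rw [← add_eq_zero_iff_eq_neg]
      ext k j
      -- Differentiate `J² = -1`, valid on the whole chart target.
      have h := partialDeriv_congr (fun z hz =>
        congrFun (congrFun (structureMatrix_mul_self J p hz) k) j) i hy
      simp only [Matrix.mul_apply] at h
      simp only [← smul_eq_mul (α := ℝ)] at h
      rw [partialDeriv_sum_smul i (fun l => hS k l) (fun l => hS l j) hyr,
        Finset.sum_add_distrib] at h
      simp only [Matrix.add_apply, Matrix.mul_apply]
      refine h.trans ?_
      simp [partialDeriv]
    · ext j k
      rw [Matrix.transpose_apply, Matrix.neg_apply, hω, hω]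
      have h : Set.EqOn (fundamentalForm g J p k j) (fun z => -fundamentalForm g J p j k z)
          (extChartAt I p).target := fun z hz => by
        have h1 := transpose_structureMatrix_mul_metricMatrix g J hK.hermitian p hz
        have h2 : ((structureMatrix J p z).transpose * metricMatrix g p z).transpose
            = -((structureMatrix J p z).transpose * metricMatrix g p z) := by
          rw [Matrix.transpose_mul, transpose_metricMatrix, Matrix.transpose_transpose, h1, neg_neg]
        rw [fundamentalForm_eq g J p k j hz]
        dsimp only
        rw [fundamentalForm_eq g J p j k hz]
        exact congrFun (congrFun h2 j) k
      rw [partialDeriv_congr h i hy]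
      simp [partialDeriv, fderivWithin_fun_neg (I.uniqueDiffOn y hyr)]
    · rw [hω, hω, hω]
      exact hK.closed p y hy i j k
  · have h := sum_structureMatrix_smul_partialDeriv J hf hJ p j hy
    simpa only [Complex.real_smul] using h
  -- Differentiating `df ∘ J = c df` within the range is legitimate because it holds on the whole
  -- chart target, boundary included.
  · have h := partialDeriv_congr (sum_structureMatrix_smul_partialDeriv J hf hJ p j) i hy
    rw [partialDeriv_sum_smul i (fun k => hS k j) hu1 hyr] at h
    simp only [Complex.real_smul] at h
    refine h.trans ?_
    rw [partialDeriv, fderivWithin_const_mul (I.uniqueDiffOn y hyr) (hu1 j)]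
    rfl

end Derivatives

/-! ### The star algebra generated by holomorphic functions -/

section Algebra

variable {m : ℕ} {H : Type*} [TopologicalSpace H]
  {I : ModelWithCorners ℝ (EuclideanSpace ℝ (Fin m)) H}
  {M : Type*} [TopologicalSpace M] [ChartedSpace H M] [IsManifold I ∞ M]

/-- The smooth functions on `M` that are holomorphic in the interior. -/
def holomorphicSubmonoid (J : AlmostComplexStructure I M) : Submonoid C(M, ℂ) where
  carrier := {f | ContMDiff I 𝓘(ℝ, ℂ) ∞ f ∧ IsHolomorphicInInterior J f}
  one_mem' := by
    refine ⟨contMDiff_const, fun x _ => ⟨mdifferentiableAt_const, fun v => ?_⟩⟩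
    have h : mfderiv I 𝓘(ℝ, ℂ) (⇑(1 : C(M, ℂ))) x = 0 := mfderiv_const
    rw [differential, h]
    exact (mul_zero _).symm
  mul_mem' := by
    rintro f h ⟨hf, hf'⟩ ⟨hh, hh'⟩
    refine ⟨(contDiff_mul (𝕜 := ℝ) (𝔸 := ℂ)).contMDiff.comp (hf.prodMk_space hh), fun x hx => ?_⟩
    obtain ⟨hfd, hfJ⟩ := hf' x hx
    obtain ⟨hhd, hhJ⟩ := hh' x hx
    have hm := hfd.hasMFDerivAt.mul hhd.hasMFDerivAt
    refine ⟨hm.mdifferentiableAt, fun v => ?_⟩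
    have key : ∀ v : TangentSpace I x, differential I (⇑(f * h)) x v
        = f x * differential I h x v + h x * differential I f x v := fun v => by
      rw [differential, ContinuousMap.coe_mul, hm.mfderiv]
      rfl
    rw [key, key, hfJ, hhJ]
    ring

omit [IsManifold I ∞ M] in
lemma differential_star {f : M → ℂ} {x : M} (hf : MDifferentiableAt I 𝓘(ℝ, ℂ) f x)
    (v : TangentSpace I x) :
    differential I (star f) x v = star (differential I f x v) := by
  have h := (Complex.conjCLE.toContinuousLinearMap.hasMFDerivAt (x := f x)).comp x hf.hasMFDerivAt
  have h' : mfderiv I 𝓘(ℝ, ℂ) (star f) x = _ := h.mfderiv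
  rw [differential, h']
  rfl

variable {g : RiemannianMetric I M} {J : AlmostComplexStructure I M}

lemma laplaceBeltrami_eq_zero_of_holomorphic (hK : IsKahler g J) {f : M → ℂ}
    (hf : ContMDiff I 𝓘(ℝ, ℂ) ∞ f) (hJ : IsHolomorphicInInterior J f) (x : M) :
    laplaceBeltrami g f x = 0 :=
  laplaceBeltrami_eq_zero hK hf Complex.I_ne_zero (fun x hx => (hJ x hx).2) x

omit [IsManifold I ∞ M] in
lemma contMDiff_star {f : M → ℂ} (hf : ContMDiff I 𝓘(ℝ, ℂ) ∞ f) :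
    ContMDiff I 𝓘(ℝ, ℂ) ∞ (star f) :=
  Complex.conjCLE.contDiff.contMDiff.comp hf

/-- Since `J` is real, conjugation turns `df ∘ J = i df` into the same equation with `-i`. -/
lemma laplaceBeltrami_star_eq_zero_of_holomorphic (hK : IsKahler g J) {f : M → ℂ}
    (hf : ContMDiff I 𝓘(ℝ, ℂ) ∞ f) (hJ : IsHolomorphicInInterior J f) (x : M) :
    laplaceBeltrami g (star f) x = 0 := by
  refine laplaceBeltrami_eq_zero hK (contMDiff_star hf) (neg_ne_zero.mpr Complex.I_ne_zero)
    (fun x hx v => ?_) x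
  obtain ⟨hd, hJx⟩ := hJ x hx
  rw [differential_star hd, differential_star hd, hJx, star_mul']
  simp

/-- By commutativity, the holomorphic and the conjugated factors of a word can be collected
separately; exactly two factors remain, as the hypothesis on `μ` requires. -/
lemma holomorphic_mul_star_of_mem_closure {f : C(M, ℂ)}
    (hf : f ∈ Submonoid.closure ((holomorphicSubmonoid J : Set C(M, ℂ))
      ∪ star (holomorphicSubmonoid J : Set C(M, ℂ)))) :
    ∃ u ∈ holomorphicSubmonoid J, ∃ h ∈ holomorphicSubmonoid J, u * star h = f := by
  induction hf using Submonoid.closure_induction with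
  | mem f hf =>
    rcases hf with hf | hf
    · exact ⟨f, hf, 1, one_mem _, by simp⟩
    · exact ⟨1, one_mem _, star f, hf, by simp⟩
  | one => exact ⟨1, one_mem _, 1, one_mem _, by simp⟩
  | mul f₁ f₂ _ _ h₁ h₂ =>
    obtain ⟨u₁, hu₁, k₁, hk₁, rfl⟩ := h₁
    obtain ⟨u₂, hu₂, k₂, hk₂, rfl⟩ := h₂
    exact ⟨u₁ * u₂, mul_mem hu₁ hu₂, k₁ * k₂, mul_mem hk₁ hk₂, by rw [star_mul']; ring⟩

lemma topologicalClosure_adjoin_holomorphic [CompactSpace M] (hsep : HolomorphicallySeparable J) :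
    (StarAlgebra.adjoin ℂ (holomorphicSubmonoid J : Set C(M, ℂ))).topologicalClosure = ⊤ := by
  refine ContinuousMap.starSubalgebra_topologicalClosure_eq_top_of_separatesPoints _
    fun x y hxy => ?_
  obtain ⟨f, hf, hfJ, hne⟩ := hsep x y hxy
  exact ⟨f, ⟨⟨f, hf.continuous⟩, StarAlgebra.subset_adjoin ℂ _ ⟨hf, hfJ⟩, rfl⟩, hne⟩

end Algebra

end KahlerCalderon

end

/-! ### Vanishing of the measure by density -/

theorem mainTheorem1 {n : ℕ} [NeZero n] {M : Type*} [TopologicalSpace M] [T2Space M]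
    [CompactSpace M] [ChartedSpace (EuclideanHalfSpace (2 * n)) M]
    [IsManifold (𝓡∂ (2 * n)) ∞ M]
    (g : KahlerCalderon.RiemannianMetric (𝓡∂ (2 * n)) M)
    (J : KahlerCalderon.AlmostComplexStructure (𝓡∂ (2 * n)) M)
    (hK : KahlerCalderon.IsKahler g J)
    (hsep : KahlerCalderon.HolomorphicallySeparable J)
    (μ : StrongDual ℂ C(M, ℂ))
    (hμ : ∀ u₁ u₂ : C(M, ℂ),
      ContMDiff (𝓡∂ (2 * n)) 𝓘(ℝ, ℂ) ∞ u₁ → ContMDiff (𝓡∂ (2 * n)) 𝓘(ℝ, ℂ) ∞ u₂ →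
      (∀ x, KahlerCalderon.laplaceBeltrami g u₁ x = 0) →
      (∀ x, KahlerCalderon.laplaceBeltrami g u₂ x = 0) →
      μ (u₁ * u₂) = 0) :
    μ = 0 := by
  set A := StarAlgebra.adjoin ℂ (KahlerCalderon.holomorphicSubmonoid J : Set C(M, ℂ)) with hA
  have hzero : ∀ f ∈ A, μ f = 0 := fun f hf => by
    have hf' : f ∈ Subalgebra.toSubmodule A.toSubalgebra := hf
    -- The star algebra is the linear span of words in holomorphic functions and their conjugates,
    -- so by linearity it suffices to treat one word.
    rw [hA, StarAlgebra.adjoin_eq_span] at hf'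
    refine (Submodule.span_le (p := LinearMap.ker μ.toLinearMap)).mpr (fun h hh => ?_) hf'
    obtain ⟨u, hu, k, hk, rfl⟩ := KahlerCalderon.holomorphic_mul_star_of_mem_closure hh
    exact hμ u (star k) hu.1 (KahlerCalderon.contMDiff_star hk.1)
      (KahlerCalderon.laplaceBeltrami_eq_zero_of_holomorphic hK hu.1 hu.2)
      (KahlerCalderon.laplaceBeltrami_star_eq_zero_of_holomorphic hK hk.1 hk.2)
  have hdense : Dense (A : Set C(M, ℂ)) := fun f => by
    have h : f ∈ A.topologicalClosure := by
      rw [hA, KahlerCalderon.topologicalClosure_adjoin_holomorphic hsep]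
      trivial
    exact h
  exact ContinuousLinearMap.ext fun f => congrFun
    (Continuous.ext_on hdense μ.continuous (continuous_const (y := (0 : ℂ))) hzero) f
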